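/- Let $k$ be an algebraically closed field. For $n\in\mathbb N$, let $K(n)$ be the $n$-Kronecker quiver (two vertices $1,2$ and $n$ arrows $\gamma_1,\dots,\gamma_n:1\to 2$) and $\mathcal K_n=kK(n)$ its path algebra. Identify a finite-dimensional $\mathcal K_n$-module $M$ with a representation, i.e. finite-dimensional $k$-vector spaces $M_1,M_2$ with linear maps $M(\gamma_i):M_1\to M_2$ ($1\le i\le n$), and put $\underline{\dim}\,M=(\dim_k M_1,\dim_k M_2)$. Let $\sigma,\sigma^-$ be the Bernstein–Gelfand–Ponomarev reflections: $$\sigma M=\Big(\ker\big(M_1^n\to M_2,\ (m_i)\mapsto\textstyle\sum_i M(\gamma_i)m_i\big),\ M_1\Big),\qquad \sigma^-M=\Big(M_2,\ \operatorname{coker}\big(M_1\to M_2^n,\ m\mapsto (M(\gamma_i)m)_i\big)\Big),$$ with $\gamma_i$ acting as the $i$-th coordinate projection, respectively as the map induced by the $i$-th coordinate inclusion. An indecomposable module $M$ is preprojective if $\sigma^tM=0$ for some integer $t\ge 0$, and preinjective if $(\sigma^-)^tM=0$ for some integer $t\ge 0$. A module is regular if it has no indecomposable direct summand that is preprojective or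 preinjective. A non-zero regular module $M$ is elementary if there is no short exact sequence $0\to L\to M\to N\to 0$ of finite-dimensional modules with $L,N$ non-zero and regular. A pair $(x,y)$ is elementary for $\mathcal K_n$ if it is the dimension vector of an elementary $\mathcal K_n$-module. Let $x,y\ge 0$ be integers with $\frac{2}{n}x\le y\le x$ and $x<n$. If $(x,y)$ is elementary for $\mathcal K_n$, then $(x,y)$ is elementary for $\mathcal K_{n+1}$. More precisely, if $M$ is an elementary $\mathcal K_n$-module with $\underline{\dim}\,M=(x,y)$, then $M$, regarded as a $\mathcal K_{n+1}$-module by letting the additional arrow $\gamma_{n+1}$ act as zero, is an elementary $\mathcal K_{n+1}$-module of dimension vector $(x,y)$. -/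

import Mathlib

universe u

/-- A finite-dimensional representation over `k` of the `n`-Kronecker quiver: a source `1`, a sink `2`
and `n` arrows from `1` to `2`. Equivalently, a finite-dimensional module over its path algebra. -/
structure KroneckerRep (k : Type u) [Field k] (n : ℕ) where
  V₁ : Type u
  V₂ : Type u
  [addCommGroup₁ : AddCommGroup V₁]
  [addCommGroup₂ : AddCommGroup V₂]
  [module₁ : Module k V₁]
  [module₂ : Module k V₂]
  [finite₁ : FiniteDimensional k V₁]
  [finite₂ : FiniteDimensional k V₂]
  /-- The linear maps by which the `n` arrows act. -/
  map : Fin n → V₁ →ₗ[k] V₂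

namespace KroneckerRep

attribute [instance] addCommGroup₁ addCommGroup₂ module₁ module₂ finite₁ finite₂

variable {k : Type u} [Field k] {n : ℕ}

/-- The dimension vector `(dim M₁, dim M₂)`. -/
noncomputable def dimVector (M : KroneckerRep k n) : ℕ × ℕ :=
  (Module.finrank k M.V₁, Module.finrank k M.V₂)

/-- `M` is the zero representation (up to isomorphism). -/
def IsZero (M : KroneckerRep k n) : Prop := Subsingleton M.V₁ ∧ Subsingleton M.V₂

/-- Morphisms of representations. -/
structure Hom (M N : KroneckerRep k n) where
  f₁ : M.V₁ →ₗ[k] N.V₁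
  f₂ : M.V₂ →ₗ[k] N.V₂
  comm : ∀ (i : Fin n) (m : M.V₁), f₂ (M.map i m) = N.map i (f₁ m)

/-- `M ≅ N`. -/
def IsIso (M N : KroneckerRep k n) : Prop :=
  ∃ f : Hom M N, Function.Bijective f.f₁ ∧ Function.Bijective f.f₂

/-- `0 → L → M → N → 0` is a short exact sequence. -/
def ShortExact {L M N : KroneckerRep k n} (f : Hom L M) (g : Hom M N) : Prop :=
  Function.Injective f.f₁ ∧ Function.Injective f.f₂ ∧
  Function.Exact f.f₁ g.f₁ ∧ Function.Exact f.f₂ g.f₂ ∧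
  Function.Surjective g.f₁ ∧ Function.Surjective g.f₂

/-- The direct sum `A ⊕ B`. -/
def directSum (A B : KroneckerRep k n) : KroneckerRep k n where
  V₁ := A.V₁ × B.V₁
  V₂ := A.V₂ × B.V₂
  map i := (A.map i).prodMap (B.map i)

def IsIndecomposable (M : KroneckerRep k n) : Prop :=
  ¬ M.IsZero ∧ ∀ A B : KroneckerRep k n, IsIso M (directSum A B) → A.IsZero ∨ B.IsZero

/-- `M₁ⁿ → M₂`, `(mᵢ)ᵢ ↦ ∑ᵢ γᵢ mᵢ`. -/
def sumMap (M : KroneckerRep k n) : (Fin n → M.V₁) →ₗ[k] M.V₂ :=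
  ∑ i, M.map i ∘ₗ LinearMap.proj i

/-- The Bernstein-Gelfand-Ponomarev reflection `σ` at the sink, the opposite quiver being
identified with the `n`-Kronecker quiver: `M₂` is replaced by the kernel of `M₁ⁿ → M₂`, which
becomes the space at the source, and the arrows act as the coordinate projections to `M₁`. -/
def sigma (M : KroneckerRep k n) : KroneckerRep k n where
  V₁ := LinearMap.ker M.sumMap
  V₂ := M.V₁
  map i := LinearMap.proj i ∘ₗ (LinearMap.ker M.sumMap).subtype

/-- The Bernstein-Gelfand-Ponomarev reflection `σ⁻` at the source: `M₁` is replaced by the cokernel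
of `M₁ → M₂ⁿ`, `m ↦ (γᵢ m)ᵢ`, which becomes the space at the sink, and the arrows act as the
coordinate inclusions of `M₂` followed by the quotient map. -/
def sigmaInv (M : KroneckerRep k n) : KroneckerRep k n where
  V₁ := M.V₂
  V₂ := (Fin n → M.V₂) ⧸ LinearMap.range (LinearMap.pi M.map)
  map i := (LinearMap.range (LinearMap.pi M.map)).mkQ ∘ₗ LinearMap.single k (fun _ => M.V₂) i

def IsPreprojective (M : KroneckerRep k n) : Prop :=
  M.IsIndecomposable ∧ ∃ t : ℕ, (sigma^[t] M).IsZero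

def IsPreinjective (M : KroneckerRep k n) : Prop :=
  M.IsIndecomposable ∧ ∃ t : ℕ, (sigmaInv^[t] M).IsZero

/-- `M` has no indecomposable direct summand that is preprojective or preinjective. -/
def IsRegular (M : KroneckerRep k n) : Prop :=
  ∀ A B : KroneckerRep k n, IsIso M (directSum A B) → ¬ A.IsPreprojective ∧ ¬ A.IsPreinjective

/-- `M` is non-zero and regular, and is not an extension of two non-zero regular representations. -/
def IsElementary (M : KroneckerRep k n) : Prop :=
  ¬ M.IsZero ∧ M.IsRegular ∧
    ¬ ∃ (L N : KroneckerRep k n) (f : Hom L M) (g : Hom M N),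
      ShortExact f g ∧ ¬ L.IsZero ∧ L.IsRegular ∧ ¬ N.IsZero ∧ N.IsRegular

/-- `M` as a representation of the `(n+1)`-Kronecker quiver, the new arrow acting as zero. -/
def extendByZero (M : KroneckerRep k n) : KroneckerRep k (n + 1) where
  V₁ := M.V₁
  V₂ := M.V₂
  map := Fin.snoc (α := fun _ => M.V₁ →ₗ[k] M.V₂) M.map 0

variable (k n) in
/-- `d` is the dimension vector of some elementary representation. -/
def IsElementaryDimVector (d : ℕ × ℕ) : Prop :=
  ∃ M : KroneckerRep k n, M.IsElementary ∧ M.dimVector = d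

/-- The set `𝐅 = {(x, y) | (2 / n) x ≤ y ≤ x}`. -/
def fundamentalDomain (n : ℕ) : Set (ℕ × ℕ) :=
  {d | (2 / n : ℚ) * d.1 ≤ d.2 ∧ d.2 ≤ d.1}

end KroneckerRep

namespace KroneckerRep

variable {k : Type u} [Field k] {n : ℕ}

open Module

/-! When both dimensions are below `n`, the only possible preprojective summand is the simple
projective and the only possible preinjective one the simple injective: on anything else, dimension
counts show that the reflections never reach zero. Regularity then depends only on direct sum
decompositions, which do not see an arrow acting as zero (`isRegular_restrict_iff`). An extension of
regular modules over the larger quiver with zero last arrow in the middle has zero last arrow at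
both ends, so it restricts to a forbidden extension over the smaller quiver. -/

theorem isZero_iff_finrank (M : KroneckerRep k n) :
    M.IsZero ↔ finrank k M.V₁ = 0 ∧ finrank k M.V₂ = 0 := by
  rw [IsZero, finrank_zero_iff, finrank_zero_iff]

/-! ### Dimensions under the reflections -/

theorem le_finrank_sigma_V₁ (M : KroneckerRep k n) :
    n * finrank k M.V₁ ≤ finrank k M.sigma.V₁ + finrank k M.V₂ := by
  have h := LinearMap.finrank_range_add_finrank_ker M.sumMap
  have h' := Submodule.finrank_le (LinearMap.range M.sumMap)
  rw [finrank_pi_fintype] at h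
  simp only [Finset.sum_const, Finset.card_univ, Fintype.card_fin, smul_eq_mul] at h
  change _ ≤ finrank k (LinearMap.ker M.sumMap) + _
  omega

theorem le_finrank_sigmaInv_V₂ (M : KroneckerRep k n) :
    n * finrank k M.V₂ ≤ finrank k M.sigmaInv.V₂ + finrank k M.V₁ := by
  have h := Submodule.finrank_quotient_add_finrank (LinearMap.range (LinearMap.pi M.map))
  have h' := LinearMap.finrank_range_le (LinearMap.pi M.map)
  rw [finrank_pi_fintype] at h
  simp only [Finset.sum_const, Finset.card_univ, Fintype.card_fin, smul_eq_mul] at h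
  change _ ≤ finrank k ((Fin n → M.V₂) ⧸ LinearMap.range (LinearMap.pi M.map)) + _
  omega

/-- The hypotheses on `(a, b) = dim M` are invariant under `sigma`: the new vector is `(a', a)` with
`a' ≥ n * a - b ≥ a`, hence `a + a' ≤ 2 * a' ≤ n * a'`. -/
theorem not_isZero_sigma_iterate (hn : 2 ≤ n) (t : ℕ) (M : KroneckerRep k n)
    (h₁ : 0 < finrank k M.V₁)
    (h : finrank k M.V₂ + finrank k M.V₁ ≤ n * finrank k M.V₁) :
    ¬ (sigma^[t] M).IsZero := by
  induction t generalizing M with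
  | zero => rw [Function.iterate_zero_apply, isZero_iff_finrank]; omega
  | succ t ih =>
    have hle := M.le_finrank_sigma_V₁
    refine ih M.sigma (by omega) ?_
    change finrank k M.V₁ + _ ≤ _
    nlinarith [Nat.mul_le_mul_right (finrank k M.sigma.V₁) hn]

theorem not_isZero_sigmaInv_iterate (hn : 2 ≤ n) (t : ℕ) (M : KroneckerRep k n)
    (h₂ : 0 < finrank k M.V₂)
    (h : finrank k M.V₁ + finrank k M.V₂ ≤ n * finrank k M.V₂) :
    ¬ (sigmaInv^[t] M).IsZero := by
  induction t generalizing M with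
  | zero => rw [Function.iterate_zero_apply, isZero_iff_finrank]; omega
  | succ t ih =>
    have hle := M.le_finrank_sigmaInv_V₂
    refine ih M.sigmaInv (by omega) ?_
    change finrank k M.V₂ + _ ≤ _
    nlinarith [Nat.mul_le_mul_right (finrank k M.sigmaInv.V₂) hn]

theorem add_le_mul_of_lt {a b : ℕ} (ha : 0 < a) (hb : b < n) : b + a ≤ n * a := by
  obtain ⟨m, rfl⟩ : ∃ m, n = m + 1 := ⟨n - 1, by omega⟩
  nlinarith [Nat.mul_le_mul_left m (Nat.succ_le_of_lt ha)]

/-- A representation with fewer than `n` dimensions at the sink is preprojective only if it is the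
simple projective. -/
theorem isPreprojective_iff_of_finrank_lt (hn : 2 ≤ n) (M : KroneckerRep k n)
    (h : finrank k M.V₂ < n) :
    M.IsPreprojective ↔ M.IsIndecomposable ∧ Subsingleton M.V₁ := by
  -- One reflection suffices if `M.V₁ = 0`: the new sink is `M.V₁` and the new source lies in its
  -- `n`-th power.
  refine and_congr_right fun _ => ⟨fun ⟨t, ht⟩ => ?_, fun h₁ => ⟨1, ?_, h₁⟩⟩
  · by_contra hV
    rw [← finrank_zero_iff (R := k)] at hV
    have hpos := Nat.pos_of_ne_zero hV
    exact not_isZero_sigma_iterate hn t M hpos (add_le_mul_of_lt hpos h) ht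
  · change Subsingleton (LinearMap.ker M.sumMap)
    infer_instance

/-- A representation with fewer than `n` dimensions at the source is preinjective only if it is the
simple injective. -/
theorem isPreinjective_iff_of_finrank_lt (hn : 2 ≤ n) (M : KroneckerRep k n)
    (h : finrank k M.V₁ < n) :
    M.IsPreinjective ↔ M.IsIndecomposable ∧ Subsingleton M.V₂ := by
  refine and_congr_right fun _ => ⟨fun ⟨t, ht⟩ => ?_, fun h₂ => ⟨1, h₂, ?_⟩⟩
  · by_contra hV
    rw [← finrank_zero_iff (R := k)] at hV
    have hpos := Nat.pos_of_ne_zero hV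
    exact not_isZero_sigmaInv_iterate hn t M hpos (add_le_mul_of_lt hpos h) ht
  · change Subsingleton ((Fin n → M.V₂) ⧸ LinearMap.range (LinearMap.pi M.map))
    infer_instance

/-! ### Restriction to the first `n` arrows -/

/-- Forget the action of the last arrow. -/
def restrict (M : KroneckerRep k (n + 1)) : KroneckerRep k n where
  V₁ := M.V₁
  V₂ := M.V₂
  map i := M.map i.castSucc

/-- A morphism, the last arrow being forgotten. -/
def Hom.restrict {M N : KroneckerRep k (n + 1)} (f : Hom M N) : Hom M.restrict N.restrict where
  f₁ := f.f₁
  f₂ := f.f₂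
  comm i m := f.comm i.castSucc m

theorem restrict_extendByZero (M : KroneckerRep k n) : M.extendByZero.restrict = M := by
  cases M
  simp [restrict, extendByZero]

theorem extendByZero_map_last (M : KroneckerRep k n) : M.extendByZero.map (Fin.last n) = 0 :=
  Fin.snoc_last (α := fun _ => M.V₁ →ₗ[k] M.V₂) _ _

theorem extendByZero_map_castSucc (M : KroneckerRep k n) (i : Fin n) :
    M.extendByZero.map i.castSucc = M.map i :=
  Fin.snoc_castSucc (α := fun _ => M.V₁ →ₗ[k] M.V₂) _ _ _

theorem IsIso.restrict_directSum {M A B : KroneckerRep k (n + 1)} (h : IsIso M (directSum A B)) :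
    IsIso M.restrict (directSum A.restrict B.restrict) := by
  obtain ⟨f, hf₁, hf₂⟩ := h
  exact ⟨⟨f.f₁, f.f₂, fun i m => f.comm i.castSucc m⟩, hf₁, hf₂⟩

theorem IsIso.directSum_extendByZero {M : KroneckerRep k (n + 1)} (hM : M.map (Fin.last n) = 0)
    {A B : KroneckerRep k n} (h : IsIso M.restrict (directSum A B)) :
    IsIso M (directSum A.extendByZero B.extendByZero) := by
  obtain ⟨f, hf₁, hf₂⟩ := h
  refine ⟨⟨f.f₁, f.f₂, fun i m => ?_⟩, hf₁, hf₂⟩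
  induction i using Fin.lastCases with
  | last =>
    change f.f₂ (M.map (Fin.last n) m) = ((A.extendByZero.map (Fin.last n)).prodMap
      (B.extendByZero.map (Fin.last n))) (f.f₁ m)
    rw [hM, extendByZero_map_last, extendByZero_map_last, LinearMap.zero_apply]
    exact f.f₂.map_zero
  | cast i =>
    refine (f.comm i m).trans ?_
    change ((A.map i).prodMap (B.map i)) (f.f₁ m) = ((A.extendByZero.map i.castSucc).prodMap
      (B.extendByZero.map i.castSucc)) (f.f₁ m)
    rw [extendByZero_map_castSucc, extendByZero_map_castSucc]
    rfl

/-- Decompositions pass down by restriction and back up by extension by zero. -/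
theorem isIndecomposable_restrict_iff {M : KroneckerRep k (n + 1)}
    (hM : M.map (Fin.last n) = 0) : M.restrict.IsIndecomposable ↔ M.IsIndecomposable :=
  and_congr_right fun _ =>
    ⟨fun h A B hAB => h A.restrict B.restrict hAB.restrict_directSum,
      fun h A B hAB => h A.extendByZero B.extendByZero (hAB.directSum_extendByZero hM)⟩

theorem finrank_eq_of_isIso_directSum {M A B : KroneckerRep k n} (h : IsIso M (directSum A B)) :
    finrank k M.V₁ = finrank k A.V₁ + finrank k B.V₁ ∧
      finrank k M.V₂ = finrank k A.V₂ + finrank k B.V₂ := by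
  obtain ⟨f, hf₁, hf₂⟩ := h
  exact ⟨(LinearEquiv.ofBijective f.f₁ hf₁).finrank_eq.trans (finrank_prod (R := k)),
    (LinearEquiv.ofBijective f.f₂ hf₂).finrank_eq.trans (finrank_prod (R := k))⟩

theorem isPreprojective_restrict_iff (hn : 2 ≤ n) {M : KroneckerRep k (n + 1)}
    (h : finrank k M.V₂ < n) (hM : M.map (Fin.last n) = 0) :
    M.restrict.IsPreprojective ↔ M.IsPreprojective := by
  rw [isPreprojective_iff_of_finrank_lt hn _ h,
    isPreprojective_iff_of_finrank_lt (by omega) _ (by omega), isIndecomposable_restrict_iff hM]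
  rfl

theorem isPreinjective_restrict_iff (hn : 2 ≤ n) {M : KroneckerRep k (n + 1)}
    (h : finrank k M.V₁ < n) (hM : M.map (Fin.last n) = 0) :
    M.restrict.IsPreinjective ↔ M.IsPreinjective := by
  rw [isPreinjective_iff_of_finrank_lt hn _ h,
    isPreinjective_iff_of_finrank_lt (by omega) _ (by omega), isIndecomposable_restrict_iff hM]
  rfl

theorem map_eq_zero_of_isIso_directSum {M A B : KroneckerRep k n} (h : IsIso M (directSum A B))
    {i : Fin n} (hM : M.map i = 0) : A.map i = 0 := by
  obtain ⟨f, hf₁, -⟩ := h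
  ext a
  obtain ⟨m, hm⟩ := hf₁.surjective (a, (0 : B.V₁))
  have hc := f.comm i m
  rw [hM, hm, LinearMap.zero_apply, map_zero] at hc
  exact (congrArg Prod.fst hc).symm

/-- In dimensions smaller than `n`, regularity does not depend on an arrow that acts as zero. -/
theorem isRegular_restrict_iff (hn : 2 ≤ n) {M : KroneckerRep k (n + 1)}
    (h₁ : finrank k M.V₁ < n) (h₂ : finrank k M.V₂ < n) (hM : M.map (Fin.last n) = 0) :
    M.restrict.IsRegular ↔ M.IsRegular := by
  constructor
  · intro h A B hAB
    have hd := finrank_eq_of_isIso_directSum hAB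
    have hA := map_eq_zero_of_isIso_directSum hAB hM
    rw [← isPreprojective_restrict_iff hn (by omega) hA,
      ← isPreinjective_restrict_iff hn (by omega) hA]
    exact h A.restrict B.restrict hAB.restrict_directSum
  · intro h A B hAB
    have hAB' := hAB.directSum_extendByZero hM
    have hd := finrank_eq_of_isIso_directSum hAB'
    have hA := map_eq_zero_of_isIso_directSum hAB' hM
    rw [← restrict_extendByZero A, isPreprojective_restrict_iff hn (by omega) hA,
      isPreinjective_restrict_iff hn (by omega) hA]
    exact h _ _ hAB'

/-- For `L` this uses injectivity at the sink, for `N` surjectivity at the source. -/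
theorem ShortExact.map_eq_zero {L M N : KroneckerRep k n} {f : Hom L M} {g : Hom M N}
    (h : ShortExact f g) {i : Fin n} (hM : M.map i = 0) : L.map i = 0 ∧ N.map i = 0 := by
  obtain ⟨-, hf₂, -, -, hg₁, -⟩ := h
  constructor
  · ext l
    apply hf₂
    rw [f.comm, hM, LinearMap.zero_apply, LinearMap.zero_apply, map_zero]
  · ext m
    obtain ⟨m, rfl⟩ := hg₁ m
    rw [← g.comm, hM, LinearMap.zero_apply, LinearMap.zero_apply, map_zero]

theorem IsElementary.of_restrict {M : KroneckerRep k (n + 1)} (hn : 2 ≤ n)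
    (h₁ : finrank k M.V₁ < n) (h₂ : finrank k M.V₂ < n) (hM : M.map (Fin.last n) = 0)
    (h : M.restrict.IsElementary) : M.IsElementary := by
  obtain ⟨h0, hreg, hext⟩ := h
  refine ⟨h0, (isRegular_restrict_iff hn h₁ h₂ hM).1 hreg, ?_⟩
  rintro ⟨L, N, f, g, hfg, hL0, hL, hN0, hN⟩
  obtain ⟨hLl, hNl⟩ := hfg.map_eq_zero hM
  have hL₁ := LinearMap.finrank_le_finrank_of_injective hfg.1
  have hL₂ := LinearMap.finrank_le_finrank_of_injective hfg.2.1
  have hN₁ := LinearMap.finrank_le_finrank_of_surjective hfg.2.2.2.2.1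
  have hN₂ := LinearMap.finrank_le_finrank_of_surjective hfg.2.2.2.2.2
  exact hext ⟨L.restrict, N.restrict, f.restrict, g.restrict, hfg, hL0,
    (isRegular_restrict_iff hn (by omega) (by omega) hLl).2 hL, hN0,
    (isRegular_restrict_iff hn (by omega) (by omega) hNl).2 hN⟩

theorem IsElementary.extendByZero {M : KroneckerRep k n} (h₁ : finrank k M.V₁ < n)
    (h₂ : finrank k M.V₂ < n) (h : M.IsElementary) : M.extendByZero.IsElementary := by
  have h0 := h.1
  rw [isZero_iff_finrank] at h0
  -- `2 ≤ n` holds because `M` is non-zero, so some dimension is at least 1 and less than `n`.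
  exact .of_restrict (by omega) h₁ h₂ M.extendByZero_map_last (by rwa [restrict_extendByZero])

end KroneckerRep

theorem mainTheorem9 {k : Type u} [Field k] [IsAlgClosed k] (n x y : ℕ)
    (hF : (x, y) ∈ KroneckerRep.fundamentalDomain n) (hx : x < n) :
    (KroneckerRep.IsElementaryDimVector k n (x, y) →
      KroneckerRep.IsElementaryDimVector k (n + 1) (x, y)) ∧
    (∀ M : KroneckerRep k n, M.dimVector = (x, y) → M.IsElementary →
      M.extendByZero.dimVector = (x, y) ∧ M.extendByZero.IsElementary) := by
  have hyx : y ≤ x := hF.2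
  have key : ∀ M : KroneckerRep k n, M.dimVector = (x, y) → M.IsElementary →
      M.extendByZero.dimVector = (x, y) ∧ M.extendByZero.IsElementary := by
    intro M hd hM
    obtain ⟨h₁, h₂⟩ := Prod.ext_iff.1 hd
    exact ⟨hd, hM.extendByZero (h₁.trans_lt hx) (h₂.trans_lt (hyx.trans_lt hx))⟩
  exact ⟨fun ⟨M, hM, hd⟩ => ⟨M.extendByZero, (key M hd hM).2, (key M hd hM).1⟩, key⟩
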